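/- A semilattice is a commutative semigroup all of whose elements are idempotent, ordered by $x\le y\iff xy=x$. A topologized semilattice is a semilattice endowed with a topology; it is a topological (resp. semitopological) semilattice if the operation $(x,y)\mapsto xy$ is jointly (resp. separately) continuous. A topologized semilattice $X$ is complete if each non-empty up-directed set $D\subset X$ has a supremum in $X$ with $\sup D\in\overline D$, and each non-empty down-directed set $D\subset X$ has an infimum in $X$ with $\inf D\in\overline D$. Let $h:X\to Y$ be a continuous homomorphism from a complete topologized semilattice $X$ to a Hausdorff semitopological semilattice $Y$. Then the image $h(X)$ is closed in $Y$ if at least one of the following conditions is satisfied: 1. $Y$ is $\bar G_\delta$-separated, that is, for any distinct points $x,y\in Y$ there exists a countable family $\mathcal U$ of closed neighborhoods of $x$ such that $\bigcap\mathcal U$ is a closed subsemilattice of $Y$ with $y\notin\bigcap\mathcal U$; 2. $Y$ is a topological semilattice; 3. the topological space $Y$ is sequential, that is, every sequentially closed subset of $Y$ is closed; 4. $Y$ satisfies the separation axiom $\vec T_{2\delta}$, that is, $Y$ admits a continuous bijective map onto a $T_{2\delta}$-space $Z$, where a space $Z$ is a $T_{2\delta}$-space if it is a $T_1$-space and for any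 open set $V\subset Z$ and any point $x\in V$ there exists a countable family $\mathcal U$ of closed neighborhoods of $x$ in $Z$ with $\bigcap\mathcal U\subset V$; 5. the topological space $Y$ is functionally Hausdorff, that is, for any distinct points $x,y\in Y$ there exists a continuous function $f:Y\to\mathbb R$ with $f(x)\ne f(y)$. -/

import Mathlib

open Topology

/-- A topologized poset is up-complete if every non-empty up-directed subset `D` has a least upper
bound, and this least upper bound lies in the closure of `D`. -/
def IsUpCompleteTop (X : Type*) [PartialOrder X] [TopologicalSpace X] : Prop :=
  ∀ D : Set X, D.Nonempty → DirectedOn (· ≤ ·) D → ∃ s, IsLUB D s ∧ s ∈ closure D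

/-- A topologized poset is down-complete if every non-empty down-directed subset `D` has a greatest
lower bound, and this greatest lower bound lies in the closure of `D`. -/
def IsDownCompleteTop (X : Type*) [PartialOrder X] [TopologicalSpace X] : Prop :=
  ∀ D : Set X, D.Nonempty → DirectedOn (· ≥ ·) D → ∃ s, IsGLB D s ∧ s ∈ closure D

/-- A topologized poset is complete if it is up-complete and down-complete. -/
def IsCompleteTop (X : Type*) [PartialOrder X] [TopologicalSpace X] : Prop :=
  IsUpCompleteTop X ∧ IsDownCompleteTop X

/-- A semitopological semilattice: the semilattice operation is separately continuous. -/
def IsSemitopologicalSemilattice (Y : Type*) [SemilatticeInf Y] [TopologicalSpace Y] : Prop :=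
  (∀ a : Y, Continuous fun y : Y => a ⊓ y) ∧ (∀ a : Y, Continuous fun y : Y => y ⊓ a)

/-- The `Ḡ_δ`-separation property: any distinct points `x`, `y` admit a countable family of closed
neighborhoods of `x` whose intersection is a closed subsemilattice that does not contain `y`. -/
def IsGDeltaBarSeparated (Y : Type*) [SemilatticeInf Y] [TopologicalSpace Y] : Prop :=
  ∀ x y : Y, x ≠ y → ∃ U : Set (Set Y), U.Countable ∧ (∀ A ∈ U, IsClosed A ∧ A ∈ 𝓝 x) ∧
    IsClosed (⋂₀ U) ∧ InfClosed (⋂₀ U) ∧ y ∉ ⋂₀ U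

/-- The separation axiom `T_{2δ}`: the space is `T₁`, and for every open set `V` and every point
`x ∈ V` there is a countable family of closed neighborhoods of `x` with intersection inside `V`. -/
def IsTTwoDelta (Y : Type*) [TopologicalSpace Y] : Prop :=
  T1Space Y ∧ ∀ (V : Set Y) (x : Y), IsOpen V → x ∈ V →
    ∃ U : Set (Set Y), U.Countable ∧ (∀ A ∈ U, IsClosed A ∧ A ∈ 𝓝 x) ∧ ⋂₀ U ⊆ V

/-- The weak form of the axiom `T_{2δ}` (written with an arrow above the `T`): the space admits a
continuous bijective map onto a `T_{2δ}`-space. -/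
def IsVecTTwoDelta.{u} (Y : Type u) [TopologicalSpace Y] : Prop :=
  ∃ (Z : Type u) (_ : TopologicalSpace Z) (f : Y → Z),
    IsTTwoDelta Z ∧ Continuous f ∧ Function.Bijective f

/-- A space is functionally Hausdorff if continuous real-valued functions separate its points. -/
def IsFunctionallyHausdorff (Y : Type*) [TopologicalSpace Y] : Prop :=
  ∀ x y : Y, x ≠ y → ∃ f : Y → ℝ, Continuous f ∧ f x ≠ f y

open Set Filter

/-! ### Completeness of the image and lower limits of filters -/

section Setup

variable {X Y : Type*} [SemilatticeInf X] [TopologicalSpace X]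
  [SemilatticeInf Y] [TopologicalSpace Y]

/-! The image `R` is complete inside `Y`, so a filter containing `R` has a lower limit in `R`: the
supremum of the infima of its members (`exists_liminf`). Let `y` be in the closure of `R`. Separate
continuity suffices to pick points near `y` recursively so that finite meets of late points stay in
prescribed neighborhoods (`exists_infClosure_subset`); the lower limit of the tails then lies in `R`
and in the closures of all these neighborhoods.

For countable families this settles condition 1, and condition 2 reduces to it. In a `T_{2δ}`-space,
induction on cardinality extends it to all neighborhoods of `y`, whence `y ∈ R`; conditions 4 and 5
reduce to this case by coarsening the topology. In a sequential space, if `y ∉ R`, a maximal chain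
of countably generated filters with strictly increasing lower limits contradicts completeness. -/

theorem IsSemitopologicalSemilattice.isClosed_Iic [T2Space Y]
    (hY : IsSemitopologicalSemilattice Y) (b : Y) : IsClosed (Iic b) := by
  have : Iic b = {t | b ⊓ t = t} := by ext t; simp
  rw [this]
  exact isClosed_eq (hY.1 b) continuous_id

theorem IsSemitopologicalSemilattice.isClosed_Ici [T2Space Y]
    (hY : IsSemitopologicalSemilattice Y) (b : Y) : IsClosed (Ici b) := by
  have : Ici b = {t | b ⊓ t = b} := by ext t; simp
  rw [this]
  exact isClosed_eq (hY.1 b) continuous_const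

/-- A subsemilattice `R` of a topologized semilattice is complete if directed subsets of `R` have
extrema in the ambient semilattice that belong to `R` and to their closure. -/
structure IsCompleteSubsemilattice (R : Set Y) : Prop where
  infClosed : InfClosed R
  exists_isLUB : ∀ D ⊆ R, D.Nonempty → DirectedOn (· ≤ ·) D → ∃ s ∈ R, IsLUB D s ∧ s ∈ closure D
  exists_isGLB : ∀ D ⊆ R, D.Nonempty → DirectedOn (· ≥ ·) D → ∃ s ∈ R, IsGLB D s ∧ s ∈ closure D

/-- Each fiber of a continuous homomorphism from a complete semilattice has a least element. -/
theorem IsCompleteTop.exists_isLeast_fiber [T1Space Y] (hX : IsCompleteTop X) (h : InfHom X Y)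
    (hcont : Continuous h) {y : Y} (hy : y ∈ range h) : ∃ m, IsLeast (h ⁻¹' {y}) m := by
  have hic : InfClosed (h ⁻¹' {y}) := by
    intro a ha b hb
    simp only [mem_preimage, mem_singleton_iff] at *
    simp [ha, hb]
  obtain ⟨x, rfl⟩ := hy
  obtain ⟨m, hm, hcl⟩ := hX.2 (h ⁻¹' {h x}) ⟨x, rfl⟩ hic.codirectedOn
  rw [(isClosed_singleton.preimage hcont).closure_eq] at hcl
  exact ⟨m, hcl, hm.1⟩

/-- Least points of fibers form a monotone section, which lifts directed sets to `X`. The images of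
their extrema are extrema in all of `Y` because the cones `Iic b` and `Ici b` are closed. -/
theorem IsCompleteTop.range [T2Space Y] (hX : IsCompleteTop X)
    (hY : IsSemitopologicalSemilattice Y) (h : InfHom X Y) (hcont : Continuous h) :
    IsCompleteSubsemilattice (Set.range h) := by
  cases isEmpty_or_nonempty X
  · rw [range_eq_empty]
    exact ⟨infClosed_empty, fun D hD hne => absurd (hne.mono hD) not_nonempty_empty,
      fun D hD hne => absurd (hne.mono hD) not_nonempty_empty⟩
  choose! m hm using fun y hy => hX.exists_isLeast_fiber h hcont (y := y) hy
  have hhm : ∀ y ∈ Set.range h, h (m y) = y := fun y hy => (hm y hy).1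
  have hmono : ∀ y ∈ Set.range h, ∀ z ∈ Set.range h, y ≤ z → m y ≤ m z := by
    intro y hy z hz hyz
    have : m y ≤ m y ⊓ m z := (hm y hy).2 (by simp [hhm y hy, hhm z hz, hyz])
    exact this.trans inf_le_right
  have himg : ∀ D ⊆ Set.range h, h '' (m '' D) = D := by
    intro D hD
    rw [image_image]
    exact (image_congr fun y hy => hhm y (hD hy)).trans (image_id' D)
  have hh : Monotone h := OrderHomClass.mono h
  have hcl : ∀ D ⊆ Set.range h, ∀ s ∈ closure (m '' D), h s ∈ closure D := by
    intro D hD s hs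
    rw [← himg D hD]
    exact image_closure_subset_closure_image hcont (mem_image_of_mem h hs)
  refine ⟨?_, ?_, ?_⟩
  · rintro _ ⟨a, rfl⟩ _ ⟨b, rfl⟩
    exact ⟨a ⊓ b, map_inf h a b⟩
  · intro D hD hne hdir
    obtain ⟨s, hs, hsc⟩ := hX.1 (m '' D) (hne.image m) (by
      rintro _ ⟨a, ha, rfl⟩ _ ⟨b, hb, rfl⟩
      obtain ⟨c, hc, hac, hbc⟩ := hdir a ha b hb
      exact ⟨m c, ⟨c, hc, rfl⟩, hmono _ (hD ha) _ (hD hc) hac, hmono _ (hD hb) _ (hD hc) hbc⟩)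
    refine ⟨h s, ⟨s, rfl⟩, ⟨?_, ?_⟩, hcl D hD s hsc⟩
    · intro d hd
      rw [← hhm d (hD hd)]
      exact hh (hs.1 ⟨d, hd, rfl⟩)
    · intro b hb
      exact closure_minimal (fun d hd => hb hd) (hY.isClosed_Iic b) (hcl D hD s hsc)
  · intro D hD hne hdir
    obtain ⟨s, hs, hsc⟩ := hX.2 (m '' D) (hne.image m) (by
      rintro _ ⟨a, ha, rfl⟩ _ ⟨b, hb, rfl⟩
      obtain ⟨c, hc, hac, hbc⟩ := hdir a ha b hb
      exact ⟨m c, ⟨c, hc, rfl⟩, hmono _ (hD hc) _ (hD ha) hac, hmono _ (hD hc) _ (hD hb) hbc⟩)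
    refine ⟨h s, ⟨s, rfl⟩, ⟨?_, ?_⟩, hcl D hD s hsc⟩
    · intro d hd
      rw [← hhm d (hD hd)]
      exact hh (hs.1 ⟨d, hd, rfl⟩)
    · intro b hb
      exact closure_minimal (fun d hd => hb hd) (hY.isClosed_Ici b) (hcl D hD s hsc)

namespace IsCompleteSubsemilattice

variable {R : Set Y}

theorem exists_isGLB_of_nonempty (hR : IsCompleteSubsemilattice R) {S : Set Y} (hS : S ⊆ R)
    (hne : S.Nonempty) : ∃ s ∈ R, IsGLB S s ∧ s ∈ closure (infClosure S) := by
  obtain ⟨s, hs, hglb, hcl⟩ := hR.exists_isGLB (infClosure S) (infClosure_min hS hR.infClosed)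
    (hne.mono subset_infClosure) infClosed_infClosure.codirectedOn
  exact ⟨s, hs, isGLB_infClosure.1 hglb, hcl⟩

/-- The greatest lower bounds of those members of a filter that lie in `R`. -/
def filterGLBs (R : Set Y) (G : Filter Y) : Set Y := {t | ∃ S ∈ G, S ⊆ R ∧ IsGLB S t}

/-- The lower limit of a filter `G` on `R`, which lies in each closed set containing the
subsemilattice generated by a member of `G`. -/
theorem exists_liminf (hR : IsCompleteSubsemilattice R) (G : Filter Y) [G.NeBot] (hG : R ∈ G) :
    ∃ z ∈ R, IsLUB (filterGLBs R G) z ∧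
      ∀ S ∈ G, ∀ C, IsClosed C → infClosure S ⊆ C → z ∈ C := by
  have hsub : filterGLBs R G ⊆ R := by
    rintro t ⟨S, hS, hSR, ht⟩
    obtain ⟨s, hs, hglb, -⟩ := hR.exists_isGLB_of_nonempty hSR (nonempty_of_mem hS)
    exact ht.unique hglb ▸ hs
  have hex : ∀ S ∈ G, S ⊆ R → ∃ t ∈ filterGLBs R G, IsGLB S t ∧ t ∈ closure (infClosure S) := by
    intro S hS hSR
    obtain ⟨s, hs, hglb, hcl⟩ := hR.exists_isGLB_of_nonempty hSR (nonempty_of_mem hS)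
    exact ⟨s, ⟨S, hS, hSR, hglb⟩, hglb, hcl⟩
  have hdir : DirectedOn (· ≤ ·) (filterGLBs R G) := by
    rintro a ⟨S, hS, hSR, ha⟩ b ⟨T, hT, hTR, hb⟩
    obtain ⟨t, htG, ht, -⟩ := hex (S ∩ T) (inter_mem hS hT) (inter_subset_left.trans hSR)
    exact ⟨t, htG, ht.mono ha inter_subset_left, ht.mono hb inter_subset_right⟩
  obtain ⟨t₀, ht₀, -⟩ := hex R hG Subset.rfl
  obtain ⟨z, hz, hlub, -⟩ := hR.exists_isLUB _ hsub ⟨t₀, ht₀⟩ hdir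
  refine ⟨z, hz, hlub, fun S hS C hC hSC => ?_⟩
  obtain ⟨t₁, ht₁, ht₁S, -⟩ := hex (S ∩ R) (inter_mem hS hG) inter_subset_right
  -- Members inside `S` give a cofinal set of infima, hence the same supremum, and these infima lie
  -- in `C`.
  set D := {t | ∃ T ∈ G, T ⊆ S ∩ R ∧ IsGLB T t} with hD
  have hDsub : D ⊆ filterGLBs R G :=
    fun t ⟨T, hT, hTS, ht⟩ => ⟨T, hT, hTS.trans inter_subset_right, ht⟩
  have hDdir : DirectedOn (· ≤ ·) D := by
    rintro a ⟨T, hT, hTS, ha⟩ b ⟨U, hU, hUS, hb⟩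
    obtain ⟨t, -, ht, -⟩ := hex (T ∩ U) (inter_mem hT hU)
      (inter_subset_left.trans (hTS.trans inter_subset_right))
    exact ⟨t, ⟨_, inter_mem hT hU, inter_subset_left.trans hTS, ht⟩,
      ht.mono ha inter_subset_left, ht.mono hb inter_subset_right⟩
  obtain ⟨w, hw, hwlub, hwcl⟩ := hR.exists_isLUB D (hDsub.trans hsub)
    ⟨t₁, _, inter_mem hS hG, Subset.rfl, ht₁S⟩ hDdir
  have hwz : w = z := by
    refine le_antisymm (hwlub.mono hlub hDsub) (hlub.2 ?_)
    rintro t ⟨T, hT, hTR, ht⟩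
    obtain ⟨u, -, hu, -⟩ := hex (T ∩ (S ∩ R)) (inter_mem hT (inter_mem hS hG))
      (inter_subset_left.trans hTR)
    exact (hu.mono ht inter_subset_left).trans
      (hwlub.1 ⟨_, inter_mem hT (inter_mem hS hG), inter_subset_right, hu⟩)
  rw [← hwz]
  refine closure_minimal ?_ hC hwcl
  rintro t ⟨T, hT, hTS, ht⟩
  obtain ⟨u, -, hu, hucl⟩ := hex T hT (hTS.trans inter_subset_right)
  rw [ht.unique hu]
  exact closure_minimal
    ((infClosure_mono (hTS.trans inter_subset_left)).trans hSC) hC hucl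

end IsCompleteSubsemilattice

end Setup

/-! ### Transfinite choice of points with controlled meets -/

section Recursion

variable {Y : Type*} [SemilatticeInf Y]

/-- The meet of `s` with the finitely many elements `x a`, `a ∈ A`. -/
def infFold {ι : Type*} (A : Finset ι) (s : Y) (x : ι → Y) : Y :=
  A.fold (fun a b : Y => a ⊓ b) s x

@[simp]
theorem infFold_empty {ι : Type*} (s : Y) (x : ι → Y) : infFold ∅ s x = s := rfl

theorem infFold_insert {ι : Type*} [DecidableEq ι] {A : Finset ι} {a : ι} (ha : a ∉ A) (s : Y)
    (x : ι → Y) : infFold (insert a A) s x = x a ⊓ infFold A s x :=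
  Finset.fold_insert ha

theorem le_infFold_iff {ι : Type*} {A : Finset ι} {x : ι → Y} {s u : Y} :
    u ≤ infFold A s x ↔ u ≤ s ∧ ∀ a ∈ A, u ≤ x a := by
  classical
  induction A using Finset.induction_on with
  | empty => simp
  | insert a A ha ih =>
    rw [infFold_insert ha, le_inf_iff, ih, Finset.forall_mem_insert]
    tauto

theorem infFold_inf {ι : Type*} (A : Finset ι) (x : ι → Y) (s t : Y) :
    infFold A (s ⊓ t) x = s ⊓ infFold A t x :=
  eq_of_forall_le_iff fun u => by
    simp only [le_infFold_iff, le_inf_iff]; tauto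

variable [TopologicalSpace Y]

theorem IsSemitopologicalSemilattice.continuous_infFold (hY : IsSemitopologicalSemilattice Y)
    {ι : Type*} (A : Finset ι) (x : ι → Y) : Continuous fun t => infFold A t x := by
  classical
  induction A using Finset.induction_on with
  | empty => simpa using continuous_id'
  | insert a A ha ih =>
    simp only [infFold_insert ha]
    exact (hY.1 (x a)).comp ih

/-- Points `x α` close to `y` can be chosen by transfinite recursion so that the meets of finitely
many points with indices at least `β` lie in a prescribed neighborhood `V β` of `y`. -/
theorem IsSemitopologicalSemilattice.exists_infClosure_subset
    (hY : IsSemitopologicalSemilattice Y) {ι : Type*} [LinearOrder ι] [WellFoundedLT ι] {y : Y}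
    (S V : ι → Set Y) (hV : ∀ β, IsOpen (V β)) (hyV : ∀ β, y ∈ V β)
    (H : ∀ α, ∀ W : Finset (Iio α) × Iic α → Set Y, (∀ j, W j ∈ 𝓝 y) →
      ∃ z ∈ S α, ∀ j, z ∈ W j) :
    ∃ x : ι → Y, (∀ α, x α ∈ S α) ∧ ∀ β, infClosure (x '' Ici β) ⊆ V β := by
  classical
  -- The guard lets the choice be made for arbitrary earlier values `f`. The conjunct with `z ⊓ y`
  -- propagates the invariant `inv`; the one with `z` gives the conclusion.
  have H' : ∀ α, ∀ f : Iio α → Y, ∃ z ∈ S α, ∀ A : Finset (Iio α), ∀ β : Iic α,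
      infFold A y f ∈ V β →
        infFold A z f ∈ V β ∧ infFold A (z ⊓ y) f ∈ V β := by
    intro α f
    obtain ⟨z, hz, h⟩ := H α (fun j => {t | infFold j.1 y f ∈ V j.2 →
        infFold j.1 t f ∈ V j.2 ∧ infFold j.1 (t ⊓ y) f ∈ V j.2}) (by
      rintro ⟨A, β⟩
      by_cases hA : infFold A y f ∈ V β
      · have h₁ := (hV β).preimage (hY.continuous_infFold A f)
        have h₂ := h₁.preimage (hY.2 y)
        filter_upwards [h₁.mem_nhds hA, h₂.mem_nhds (by simpa using hA)] with t ht ht' _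
        exact ⟨ht, ht'⟩
      · filter_upwards with t h using absurd h hA)
    exact ⟨z, hz, fun A β => h (A, β)⟩
  choose g hgS hg using H'
  let x : ι → Y := (wellFounded_lt (α := ι)).fix fun α f => g α fun a => f a a.2
  have hx : ∀ α, x α = g α fun a => x a := fun α => WellFounded.fix_eq _ _ _
  have key : ∀ α, ∀ A : Finset ι, (∀ a ∈ A, a < α) → ∀ β ≤ α, infFold A y x ∈ V β →
      infFold A (x α) x ∈ V β ∧ infFold A (x α ⊓ y) x ∈ V β := by
    intro α A hA β hβ hyA
    have hAs : (A.subtype (· ∈ Iio α)).map (Function.Embedding.subtype _) = A :=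
      Finset.subtype_map_of_mem hA
    have := hg α (fun a => x a) (A.subtype (· ∈ Iio α)) ⟨β, hβ⟩
    rw [← hx] at this
    have hf : ∀ t, infFold (A.subtype (· ∈ Iio α)) t (fun a => x a)
        = infFold A t x := by
      intro t
      conv_rhs => rw [← hAs, infFold, Finset.fold_map]
      rfl
    simp only [hf] at this
    exact this hyA
  have inv : ∀ β, ∀ A : Finset ι, (∀ a ∈ A, β ≤ a) → infFold A y x ∈ V β := by
    intro β A
    induction A using Finset.induction_on_max with
    | empty => intro _; simpa using hyV β
    | insert a A hA ih =>
      intro h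
      rw [Finset.forall_mem_insert] at h
      rw [infFold_insert (fun ha => (hA a ha).false), ← infFold_inf]
      exact (key a A hA β h.1 (ih h.2)).2
  refine ⟨x, fun α => hx α ▸ hgS α _, fun β => ?_⟩
  have hmin : infClosure (x '' Ici β) ⊆
      {u | ∃ A : Finset ι, ∃ hA : A.Nonempty, (∀ a ∈ A, β ≤ a) ∧ u = A.inf' hA x} := by
    refine infClosure_min ?_ ?_
    · rintro _ ⟨a, ha, rfl⟩
      exact ⟨{a}, Finset.singleton_nonempty a, by simpa using ha, by simp⟩
    · rintro _ ⟨A, hA, hAβ, rfl⟩ _ ⟨B, hB, hBβ, rfl⟩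
      refine ⟨A ∪ B, hA.mono Finset.subset_union_left, ?_, (Finset.inf'_union hA hB x).symm⟩
      intro a ha
      exact (Finset.mem_union.1 ha).elim (hAβ a) (hBβ a)
  intro u hu
  obtain ⟨A, hA, hAβ, rfl⟩ := hmin hu
  -- The largest index was chosen last, so `key` applies to it over the remaining ones.
  set α := A.max' hA
  have hα : α ∈ A := A.max'_mem hA
  have hlt : ∀ a ∈ A.erase α, a < α := fun a ha =>
    lt_of_le_of_ne (A.le_max' a (Finset.mem_of_mem_erase ha)) (Finset.ne_of_mem_erase ha)
  have hβ : ∀ a ∈ A.erase α, β ≤ a := fun a ha => hAβ a (Finset.mem_of_mem_erase ha)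
  have : A.inf' hA x = infFold (A.erase α) (x α) x :=
    eq_of_forall_le_iff fun u => by
      rw [le_infFold_iff, Finset.le_inf'_iff, ← Finset.forall_mem_insert (p := fun a => u ≤ x a),
        Finset.insert_erase hα]
  rw [this]
  exact (key α _ hlt β (hAβ α hα) (inv β _ hβ)).1

/-- The limit points produced by `IsSemitopologicalSemilattice.exists_infClosure_subset`. -/
theorem IsCompleteSubsemilattice.exists_mem_forall_closure {R : Set Y}
    (hR : IsCompleteSubsemilattice R) (hY : IsSemitopologicalSemilattice Y) {ι : Type*}
    [LinearOrder ι] [WellFoundedLT ι] [Nonempty ι] {y : Y}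
    (V : ι → Set Y) (hV : ∀ β, V β ∈ 𝓝 y)
    (H : ∀ α : ι, ∀ W : Finset (Iio α) × Iic α → Set Y, (∀ j, W j ∈ 𝓝 y) →
      ∃ z ∈ R, ∀ j, z ∈ W j) :
    ∃ z ∈ R, ∀ β, z ∈ closure (V β) := by
  obtain ⟨x, hxR, hx⟩ := hY.exists_infClosure_subset (fun _ => R) (fun β => interior (V β))
    (fun β => isOpen_interior) (fun β => mem_interior_iff_mem_nhds.2 (hV β)) H
  obtain ⟨z, hz, -, hzC⟩ := hR.exists_liminf (Filter.map x atTop)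
    (mem_map.2 (univ_mem' hxR))
  exact ⟨z, hz, fun β : ι => hzC _ (image_mem_map (Ici_mem_atTop β)) _ isClosed_closure
    ((hx β).trans (interior_subset.trans subset_closure))⟩

end Recursion

/-! ### Countable families of neighborhoods; conditions 1 and 2 -/

section Countable

variable {Y : Type*} [SemilatticeInf Y] [TopologicalSpace Y] {R : Set Y} {y : Y}

theorem exists_seq_closed_nhds {Y : Type*} [TopologicalSpace Y] {y : Y} {U : Set (Set Y)}
    (hU : U.Countable) (hUn : ∀ A ∈ U, IsClosed A ∧ A ∈ 𝓝 y) :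
    ∃ f : ℕ → Set Y, (∀ n, IsClosed (f n) ∧ f n ∈ 𝓝 y) ∧ ⋂ n, f n = ⋂₀ U := by
  -- Adding `univ` makes the family nonempty without changing its intersection.
  obtain ⟨f, hf⟩ := (hU.insert univ).exists_eq_range (insert_nonempty _ _)
  refine ⟨f, fun n => ?_, by rw [← sInter_range, ← hf, sInter_insert, univ_inter]⟩
  rcases (hf ▸ mem_range_self n : f n ∈ insert univ U) with h | h
  · simp [h]
  · exact hUn _ h

theorem exists_mem_forall_of_finite {Y J : Type*} [TopologicalSpace Y] [Finite J] {y : Y}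
    {G : Filter Y} [G.NeBot] (hG : G ≤ 𝓝 y) {S : Set Y} (hS : S ∈ G) (W : J → Set Y)
    (hW : ∀ j, W j ∈ 𝓝 y) : ∃ z ∈ S, ∀ j, z ∈ W j := by
  obtain ⟨z, hz, hzW⟩ :=
    Filter.nonempty_of_mem (inter_mem hS (hG (Filter.iInter_mem.2 hW)))
  exact ⟨z, hz, mem_iInter.1 hzW⟩

theorem exists_mem_forall_of_mem_closure {Y J : Type*} [TopologicalSpace Y] [Finite J] {R : Set Y}
    {y : Y} (hy : y ∈ closure R)
    (W : J → Set Y) (hW : ∀ j, W j ∈ 𝓝 y) : ∃ z ∈ R, ∀ j, z ∈ W j := by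
  have : (𝓝[R] y).NeBot := mem_closure_iff_nhdsWithin_neBot.1 hy
  exact exists_mem_forall_of_finite nhdsWithin_le_nhds self_mem_nhdsWithin W hW

/-- A countable family of closed neighborhoods of `y ∈ closure R` has a common point in `R`. -/
theorem IsCompleteSubsemilattice.inter_sInter_nonempty (hR : IsCompleteSubsemilattice R)
    (hY : IsSemitopologicalSemilattice Y) (hy : y ∈ closure R) {U : Set (Set Y)}
    (hU : U.Countable) (hUn : ∀ A ∈ U, IsClosed A ∧ A ∈ 𝓝 y) : (R ∩ ⋂₀ U).Nonempty := by
  obtain ⟨f, hfU, hf⟩ := exists_seq_closed_nhds hU hUn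
  obtain ⟨z, hz, hzf⟩ := hR.exists_mem_forall_closure hY f (fun n => (hfU n).2)
    -- Stage `n : ℕ` imposes only finitely many conditions.
    fun n W hW => by
      obtain ⟨z, hz, hzW⟩ := exists_mem_forall_of_mem_closure hy W hW
      exact ⟨z, hz, hzW⟩
  refine ⟨z, hz, hf ▸ mem_iInter.2 fun n => ?_⟩
  exact (hfU n).1.closure_eq ▸ hzf n

/-- One lower limit serves all countable families in `𝒰` at once: it lies in every closed `⋂₀ U`, so
separation forces it to be `y`. -/
theorem IsCompleteSubsemilattice.isClosed_of_isGDeltaBarSeparated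
    (hR : IsCompleteSubsemilattice R) (hY : IsSemitopologicalSemilattice Y)
    (hsep : IsGDeltaBarSeparated Y) : IsClosed R := by
  refine isClosed_of_closure_subset fun y hy => ?_
  let 𝒰 : Set (Set (Set Y)) := {U | U.Countable ∧ (∀ A ∈ U, IsClosed A ∧ A ∈ 𝓝 y) ∧
    InfClosed (⋂₀ U)}
  let G : Filter Y := ⨅ U ∈ 𝒰, 𝓟 (R ∩ ⋂₀ U)
  have hne : 𝒰.Nonempty := ⟨∅, countable_empty, by simp, by simp⟩
  have hdir : DirectedOn ((fun U : Set (Set Y) => 𝓟 (R ∩ ⋂₀ U)) ⁻¹'o (· ≥ ·)) 𝒰 := by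
    rintro U ⟨hU, hUn, hUi⟩ V ⟨hV, hVn, hVi⟩
    refine ⟨U ∪ V, ⟨hU.union hV, ?_, ?_⟩, ?_, ?_⟩
    · rintro A (hA | hA)
      exacts [hUn A hA, hVn A hA]
    · rw [sInter_union]
      exact hUi.inter hVi
    · exact principal_mono.2 (inter_subset_inter_right _ (sInter_subset_sInter subset_union_left))
    · exact principal_mono.2 (inter_subset_inter_right _ (sInter_subset_sInter subset_union_right))
  have hmem : ∀ {t}, t ∈ G ↔ ∃ U ∈ 𝒰, R ∩ ⋂₀ U ⊆ t := by
    intro t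
    simp only [G, mem_biInf_of_directed hdir hne, mem_principal]
  have : G.NeBot := by
    rw [← empty_mem_iff_bot.not.trans neBot_iff.symm, hmem]
    rintro ⟨U, ⟨hU, hUn, -⟩, hemp⟩
    exact (hR.inter_sInter_nonempty hY hy hU hUn).not_subset_empty hemp
  obtain ⟨U₀, hU₀⟩ := hne
  obtain ⟨z, hz, -, hzC⟩ := hR.exists_liminf G (hmem.2 ⟨U₀, hU₀, inter_subset_left⟩)
  by_contra hyR
  obtain ⟨U, hU, hUn, hUcl, hUi, hzU⟩ := hsep y z (by rintro rfl; exact hyR hz)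
  exact hzU (hzC _ (hmem.2 ⟨U, ⟨hU, hUn, hUi⟩, Subset.rfl⟩) _ hUcl
    (infClosure_min inter_subset_right hUi))

/-- Joint continuity gives neighborhoods with meets of pairs from `W (n + 1)` in `W n`; the
intersection of their closures is then a subsemilattice. -/
theorem isGDeltaBarSeparated_of_continuousInf [T2Space Y] [ContinuousInf Y] :
    IsGDeltaBarSeparated Y := by
  intro x y hxy
  obtain ⟨U₀, hU₀, V₀, hV₀, hd⟩ := t2_separation_nhds hxy |>.imp fun U h => by
    obtain ⟨V, hU, hV, hd⟩ := h
    exact (⟨hU, V, hV, hd⟩ : U ∈ 𝓝 x ∧ ∃ V, V ∈ 𝓝 y ∧ Disjoint U V)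
  have hstep : ∀ U : {U // U ∈ 𝓝 x}, ∃ V : {V // V ∈ 𝓝 x},
      ∀ a ∈ V.1, ∀ b ∈ V.1, a ⊓ b ∈ U.1 := by
    rintro ⟨U, hU⟩
    have ht : Tendsto (fun p : Y × Y => p.1 ⊓ p.2) (𝓝 x ×ˢ 𝓝 x) (𝓝 x) := by
      have := (continuous_inf (L := Y)).tendsto (x, x)
      rwa [nhds_prod_eq, inf_idem] at this
    obtain ⟨V, hV, hVU⟩ := mem_prod_same_iff.1 (ht hU)
    exact ⟨⟨V, hV⟩, fun a ha b hb => hVU (mk_mem_prod ha hb)⟩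
  choose g hg using hstep
  let W : ℕ → {U // U ∈ 𝓝 x} := fun n => n.rec ⟨U₀, hU₀⟩ fun _ U => g U
  refine ⟨range fun n => closure (W n).1, countable_range _, ?_, ?_, ?_, ?_⟩
  · rintro _ ⟨n, rfl⟩
    exact ⟨isClosed_closure, mem_of_superset (W n).2 subset_closure⟩
  · exact isClosed_sInter (by rintro _ ⟨n, rfl⟩; exact isClosed_closure)
  · rintro a ha b hb _ ⟨n, rfl⟩
    exact map_mem_closure₂ continuous_inf (ha _ ⟨n + 1, rfl⟩) (hb _ ⟨n + 1, rfl⟩)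
      fun a ha b hb => hg (W n) a ha b hb
  · intro hy
    obtain ⟨z, hzV, hzU⟩ := mem_closure_iff_nhds.1 (hy _ ⟨0, rfl⟩) V₀ hV₀
    exact hd.ne_of_mem hzU hzV rfl

end Countable

/-! ### Induction on cardinality in `T_{2δ}`-spaces -/

section Cardinality

open Cardinal

theorem IsTTwoDelta.t2Space {Y : Type*} [TopologicalSpace Y] (h : IsTTwoDelta Y) : T2Space Y := by
  have := h.1
  refine t2Space_iff_disjoint_nhds.2 fun x y hxy => ?_
  obtain ⟨U, -, hU, hUV⟩ := h.2 {y}ᶜ x isOpen_compl_singleton hxy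
  have hy : y ∉ ⋂₀ U := fun hy => hUV hy rfl
  simp only [mem_sInter, not_forall] at hy
  obtain ⟨A, hA, hyA⟩ := hy
  exact disjoint_of_disjoint_of_mem disjoint_compl_right (hU A hA).2
    ((hU A hA).1.isOpen_compl.mem_nhds hyA)

/-- This counts the conditions imposed at stage `α` of the recursion, so that the induction
hypothesis applies to them. -/
theorem mk_finset_Iio_prod_Iic_lt {c : Cardinal} (hc : ℵ₀ ≤ c) (α : c.ord.ToType) :
    #(Finset (Iio α) × Iic α) < c := by
  have h₁ : #(Iio α) < c := by simpa using mk_Iio_lt α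
  have h₂ : #(Iic α) < c := by
    rw [← Iio_insert]
    exact mk_insert_le.trans_lt (add_lt_of_lt hc h₁ (one_lt_aleph0.trans_le hc))
  have h₃ : #(Finset (Iio α)) < c := by
    cases finite_or_infinite (Iio α)
    · exact (lt_aleph0_of_finite _).trans_le hc
    · rwa [mk_finset_of_infinite]
  rw [mk_prod, lift_id, lift_id]
  exact mul_lt_of_lt hc h₃ h₂

theorem IsTTwoDelta.exists_seq {Y : Type*} [TopologicalSpace Y] (h : IsTTwoDelta Y) {y : Y}
    {W : Set Y} (hW : W ∈ 𝓝 y) :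
    ∃ U : ℕ → Set Y, (∀ n, IsClosed (U n) ∧ U n ∈ 𝓝 y) ∧ ⋂ n, U n ⊆ W := by
  obtain ⟨U, hU, hUn, hUW⟩ := h.2 (interior W) y isOpen_interior (mem_interior_iff_mem_nhds.2 hW)
  obtain ⟨f, hfU, hf⟩ := exists_seq_closed_nhds hU hUn
  exact ⟨f, hfU, hf.trans_subset (hUW.trans interior_subset)⟩

variable {Y : Type*} [SemilatticeInf Y] [TopologicalSpace Y] {R : Set Y} {y : Y}

/-- Each `W j` is replaced by countably many closed neighborhoods, which keeps the cardinality `c`.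
Along the initial ordinal of `c`, every stage meets fewer than `c` conditions. -/
theorem IsCompleteSubsemilattice.exists_mem_forall_of_isTTwoDelta
    (hR : IsCompleteSubsemilattice R) (hY : IsSemitopologicalSemilattice Y) (hT : IsTTwoDelta Y)
    (hy : y ∈ closure R) {J : Type*} (W : J → Set Y) (hW : ∀ j, W j ∈ 𝓝 y) :
    ∃ z ∈ R, ∀ j, z ∈ W j := by
  induction hc : #J using WellFoundedLT.induction generalizing J with | _ c ih
  cases finite_or_infinite J
  · exact exists_mem_forall_of_mem_closure hy W hW
  choose U hU hUW using fun j => hT.exists_seq (hW j)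
  have hc₀ : ℵ₀ ≤ c := hc ▸ aleph0_le_mk J
  obtain ⟨e⟩ : Nonempty (c.ord.ToType ≃ J × ℕ) := by
    rw [← Cardinal.eq, mk_ord_toType, mk_prod, lift_uzero, mk_nat, lift_aleph0, hc,
      mul_aleph0_eq hc₀]
  have : Nonempty c.ord.ToType := e.nonempty
  obtain ⟨z, hz, hzU⟩ := hR.exists_mem_forall_closure hY (fun α => U (e α).1 (e α).2)
    (fun α => (hU _ _).2)
    fun α W hW => ih _ (mk_finset_Iio_prod_Iic_lt hc₀ α) W hW rfl
  refine ⟨z, hz, fun j => hUW j (mem_iInter.2 fun n => ?_)⟩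
  simpa [(hU j n).1.closure_eq] using hzU (e.symm (j, n))

theorem IsCompleteSubsemilattice.isClosed_of_isTTwoDelta
    (hR : IsCompleteSubsemilattice R) (hY : IsSemitopologicalSemilattice Y)
    (hT : IsTTwoDelta Y) : IsClosed R := by
  refine isClosed_of_closure_subset fun y hy => ?_
  obtain ⟨z, hz, hzW⟩ := hR.exists_mem_forall_of_isTTwoDelta hY hT hy
    (fun W : {W // W ∈ 𝓝 y} => W.1) fun W => W.2
  have := hT.1
  have : z = y := by
    by_contra hzy
    exact hzW ⟨{z}ᶜ, isOpen_compl_singleton.mem_nhds (Ne.symm hzy)⟩ rfl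
  exact this ▸ hz

end Cardinality

/-! ### Coarser `T_{2δ}` topologies; conditions 4 and 5 -/

section InducedTopology

/-- As an inequality of filters, the axiom can be checked factor by factor for an infimum of induced
topologies. -/
theorem IsTTwoDelta.countableGenerate_le {Y : Type*} [TopologicalSpace Y] (h : IsTTwoDelta Y)
    (y : Y) : countableGenerate {A | IsClosed A ∧ A ∈ 𝓝 y} ≤ 𝓝 y := by
  intro W hW
  obtain ⟨U, hU, hUn, hUW⟩ := h.2 (interior W) y isOpen_interior (mem_interior_iff_mem_nhds.2 hW)
  exact mem_countableGenerate_iff.2 ⟨U, hUn, hU, hUW.trans interior_subset⟩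

theorem isTTwoDelta_of_t3Space {Y : Type*} [TopologicalSpace Y] [T3Space Y] : IsTTwoDelta Y := by
  refine ⟨inferInstance, fun V x hV hx => ?_⟩
  obtain ⟨A, hA, hAc, hAV⟩ := exists_mem_nhds_isClosed_subset (hV.mem_nhds hx)
  exact ⟨{A}, countable_singleton A, by simp [hA, hAc], by simpa using hAV⟩

theorem isTTwoDelta_iInf_induced {Y ι : Type*} {Z : ι → Type*} [t : ∀ i, TopologicalSpace (Z i)]
    (hZ : ∀ i, IsTTwoDelta (Z i)) (g : ∀ i, Y → Z i) (hg : ∀ x y, x ≠ y → ∃ i, g i x ≠ g i y) :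
    @IsTTwoDelta Y (⨅ i, (t i).induced (g i)) := by
  let _ : TopologicalSpace Y := ⨅ i, (t i).induced (g i)
  have hcont : ∀ i, Continuous (g i) := fun i => continuous_iff_le_induced.2 (iInf_le _ i)
  refine ⟨?_, fun V x hV hx => ?_⟩
  · refine t1Space_iff_exists_open.2 fun x y hxy => ?_
    obtain ⟨i, hi⟩ := hg x y hxy
    have := (hZ i).1
    exact ⟨g i ⁻¹' {g i y}ᶜ, isOpen_compl_singleton.preimage (hcont i), hi, by simp⟩
  · have hle : countableGenerate {A | IsClosed A ∧ A ∈ 𝓝 x} ≤ 𝓝 x := by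
      conv_rhs => rw [nhds_iInf]
      refine le_iInf fun i => ?_
      rw [nhds_induced, ← map_le_iff_le_comap]
      refine le_trans ?_ ((hZ i).countableGenerate_le (g i x))
      rw [le_countableGenerate_iff_of_countableInterFilter]
      rintro A ⟨hA, hAx⟩
      exact CountableGenerateSets.basic
        ⟨hA.preimage (hcont i), (hcont i).continuousAt.preimage_mem_nhds hAx⟩
    obtain ⟨U, hU, hUc, hUV⟩ := mem_countableGenerate_iff.1 (hle (hV.mem_nhds hx))
    exact ⟨U, hUc, hU, hUV⟩

variable {Y : Type*}

theorem IsFunctionallyHausdorff.isVecTTwoDelta [t : TopologicalSpace Y]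
    (h : IsFunctionallyHausdorff Y) : IsVecTTwoDelta Y := by
  refine ⟨Y, ⨅ f : {f : Y → ℝ // Continuous f}, TopologicalSpace.induced f.1 inferInstance, id,
    isTTwoDelta_iInf_induced (fun _ => isTTwoDelta_of_t3Space) _ ?_, ?_, Function.bijective_id⟩
  · intro x y hxy
    obtain ⟨f, hf, hne⟩ := h x y hxy
    exact ⟨⟨f, hf⟩, hne⟩
  · rw [continuous_id_iff_le]
    exact le_iInf fun f => continuous_iff_le_induced.1 f.2

/-- A continuous injection of a semitopological semilattice into a `T_{2δ}`-space yields a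
coarser topology that is itself `T_{2δ}` and semitopological. -/
theorem IsSemitopologicalSemilattice.exists_isTTwoDelta [SemilatticeInf Y] [t : TopologicalSpace Y]
    (hY : IsSemitopologicalSemilattice Y) {Z : Type*} [tZ : TopologicalSpace Z]
    (hZ : IsTTwoDelta Z) {f : Y → Z} (hf : Continuous f) (hinj : Function.Injective f) :
    ∃ s : TopologicalSpace Y, t ≤ s ∧ @IsSemitopologicalSemilattice Y _ s ∧ @IsTTwoDelta Y s := by
  -- The family is stable under precomposition with translations, which makes them continuous;
  -- `none` gives `f` itself, which separates points.
  let g : Option Y → Y → Z := fun p x => p.elim (f x) fun a => f (a ⊓ x)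
  have hg : ∀ p, Continuous (g p) := by
    rintro (_ | a)
    exacts [hf, hf.comp (hY.1 a)]
  let s : TopologicalSpace Y := ⨅ p, tZ.induced (g p)
  have hs : ∀ p, Continuous[s, tZ] (g p) := fun p => continuous_iff_le_induced.2 (iInf_le _ p)
  have hleft : ∀ a : Y, Continuous[s, s] fun y => a ⊓ y := by
    intro a
    refine continuous_iInf_rng.2 fun p => continuous_induced_rng.2 ?_
    rcases p with _ | b
    · exact hs (some a)
    · convert hs (some (b ⊓ a)) using 1
      funext x
      simp [g, inf_assoc]
  refine ⟨s, le_iInf fun p => continuous_iff_le_induced.1 (hg p), ⟨hleft, fun a => ?_⟩,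
    isTTwoDelta_iInf_induced (fun _ => hZ) g fun x y hxy => ⟨none, fun h => hxy (hinj h)⟩⟩
  simpa only [inf_comm] using hleft a

theorem isClosed_range_of_isVecTTwoDelta {X : Type*} [SemilatticeInf X] [TopologicalSpace X]
    [SemilatticeInf Y] [t : TopologicalSpace Y]
    (hX : IsCompleteTop X) (hY : IsSemitopologicalSemilattice Y)
    (h : InfHom X Y) (hcont : Continuous h) (hT : IsVecTTwoDelta Y) :
    IsClosed (Set.range h) := by
  obtain ⟨Z, tZ, f, hZ, hf, hbij⟩ := hT
  obtain ⟨s, hts, hs, hsT⟩ := hY.exists_isTTwoDelta hZ hf hbij.1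
  have := @IsTTwoDelta.t2Space Y s hsT
  have hR := @IsCompleteTop.range X Y _ _ _ s _ hX hs h (continuous_le_rng hts hcont)
  have hcl := @IsCompleteSubsemilattice.isClosed_of_isTTwoDelta Y _ s _ hR hs hsT
  exact IsClosed.mono hcl hts

end InducedTopology

/-! ### Chains of filters in sequential spaces; condition 3 -/

section Sequential

variable {Y : Type*} [SemilatticeInf Y] [TopologicalSpace Y] {R : Set Y} {y : Y}

/-- A countably generated filter converging to `y ∉ R` has a countably generated refinement with a
different lower limit. -/
theorem IsCompleteSubsemilattice.exists_le_isLUB_ne [T2Space Y]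
    (hR : IsCompleteSubsemilattice R) (hY : IsSemitopologicalSemilattice Y)
    {G : Filter Y} [G.NeBot] [G.IsCountablyGenerated] (hGR : R ∈ G) (hG : G ≤ 𝓝 y) {z : Y}
    (hz : z ≠ y) : ∃ G' ≤ G, G'.NeBot ∧ G'.IsCountablyGenerated ∧
      ∃ z' ≠ z, IsLUB (IsCompleteSubsemilattice.filterGLBs R G') z' := by
  obtain ⟨B, hB⟩ := G.exists_antitone_basis
  obtain ⟨U, V, hU, hV, hzU, hyV, hd⟩ := t2_separation hz
  -- Choosing `x n` in `B n` makes the tail filter refine `G`; keeping meets in `V` keeps the new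
  -- limit out of `U`, hence away from `z`.
  obtain ⟨x, hxB, hxV⟩ := hY.exists_infClosure_subset B (fun _ => V) (fun _ => hV) (fun _ => hyV)
    fun n W hW => exists_mem_forall_of_finite hG (hB.mem n) W hW
  have hle : Filter.map x atTop ≤ G := by
    refine hB.1.ge_iff.2 fun n _ => ?_
    refine mem_map.2 (mem_of_superset (Ici_mem_atTop n) fun k hk => ?_)
    exact hB.2 hk (hxB k)
  obtain ⟨z', -, hlub, hzC⟩ := hR.exists_liminf (Filter.map x atTop) (hle hGR)
  refine ⟨_, hle, inferInstance, inferInstance, z', ?_, hlub⟩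
  rintro rfl
  exact hzC _ (image_mem_map (Ici_mem_atTop 0)) Uᶜ hU.isClosed_compl
    ((hxV 0).trans hd.subset_compl_left) hzU

theorem IsCompleteSubsemilattice.isClosed_of_sequentialSpace [T2Space Y] [SequentialSpace Y]
    (hR : IsCompleteSubsemilattice R) (hY : IsSemitopologicalSemilattice Y) : IsClosed R := by
  refine IsSeqClosed.isClosed fun u y hu huy => ?_
  by_contra hyR
  let P := {G : Filter Y // G.NeBot ∧ G.IsCountablyGenerated ∧ R ∈ G ∧ G ≤ 𝓝 y}
  have hlim : ∀ G : P, ∃ z ∈ R, IsLUB (filterGLBs R G.1) z := by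
    rintro ⟨G, hne, -, hGR, -⟩
    obtain ⟨z, hz, hlub, -⟩ := hR.exists_liminf G hGR
    exact ⟨z, hz, hlub⟩
  choose z hzR hz using hlim
  have hmono : ∀ G G' : P, G'.1 ≤ G.1 → z G ≤ z G' := fun G G' hle =>
    (hz G).mono (hz G') fun t ⟨S, hS, hSR, ht⟩ => ⟨S, hle hS, hSR, ht⟩
  have hsucc : ∀ G : P, ∃ G' : P, G'.1 ≤ G.1 ∧ z G < z G' := by
    rintro G
    obtain ⟨hne, hcg, hGR, hGy⟩ := G.2
    obtain ⟨G', hle, hne', hcg', z', hz', hlub⟩ := hR.exists_le_isLUB_ne hY hGR hGy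
      (z := z G) (fun h => hyR (h ▸ hzR G))
    let Q : P := ⟨G', hne', hcg', hle hGR, hle.trans hGy⟩
    refine ⟨Q, hle, lt_of_le_of_ne (hmono G Q hle) fun h => hz' ?_⟩
    rw [h]
    exact hlub.unique (hz Q)
  let r : P → P → Prop := fun G G' => G'.1 ≤ G.1 ∧ z G < z G'
  obtain ⟨M, hM⟩ : ∃ M, IsMaxChain r M := ⟨_, maxChain_spec⟩
  -- A filter refining all of `M` would have a successor extending the maximal chain.
  have hnoub : ∀ G : P, ∃ G' ∈ M, ¬ G.1 ≤ G'.1 := by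
    intro G
    by_contra! hG
    obtain ⟨G', hle, hlt⟩ := hsucc G
    have hr : ∀ Q ∈ M, r Q G' := fun Q hQ =>
      ⟨hle.trans (hG Q hQ), (hmono Q G (hG Q hQ)).trans_lt hlt⟩
    have hmem : G' ∈ M := by
      have := hM.2 (hM.1.insert fun Q hQ _ => Or.inr (hr Q hQ)) (subset_insert G' M)
      rw [this]
      exact mem_insert _ _
    exact (hr G' hmem).2.false
  -- A countable infimum of members of `M` stays in `P`, so by `hnoub` some member of `M` lies
  -- beyond them all.
  have hub : ∀ Q : ℕ → P, (∀ n, Q n ∈ M) → ∃ G ∈ M, ∀ n, z (Q n) < z G := by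
    intro Q hQ
    have hdir : Directed (· ≥ ·) fun n => (Q n).1 := by
      intro m n
      by_cases hmn : Q m = Q n
      · exact ⟨m, le_rfl, by simp [hmn]⟩
      · rcases hM.1 (hQ m) (hQ n) hmn with h | h
        · exact ⟨n, h.1, le_rfl⟩
        · exact ⟨m, le_rfl, h.1⟩
    have hne : (⨅ n, (Q n).1).NeBot := iInf_neBot_of_directed' hdir fun n => (Q n).2.1
    have hcg : ∀ n, (Q n).1.IsCountablyGenerated := fun n => (Q n).2.2.1
    obtain ⟨G, hG, hnle⟩ := hnoub ⟨⨅ n, (Q n).1, hne, inferInstance,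
      iInf_le (fun n => (Q n).1) 0 (Q 0).2.2.2.1, (iInf_le _ 0).trans (Q 0).2.2.2.2⟩
    refine ⟨G, hG, fun n => ?_⟩
    have hn : ¬ (Q n).1 ≤ G.1 := fun h => hnle ((iInf_le _ n).trans h)
    rcases hM.1 (hQ n) hG (by rintro rfl; exact hn le_rfl) with h | h
    exacts [h.2, absurd h.1 hn]
  -- Closedness puts the supremum of the limits below some `z G`, although `M` has no largest limit.
  have hC : IsClosed {t | ∃ G ∈ M, t ≤ z G} := by
    refine IsSeqClosed.isClosed fun v t hv hvt => ?_
    choose Q hQ hvQ using hv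
    obtain ⟨G, hG, hlt⟩ := hub Q hQ
    exact ⟨G, hG, (hY.isClosed_Iic (z G)).mem_of_tendsto hvt
      (Eventually.of_forall fun n => (hvQ n).trans (hlt n).le)⟩
  have huR : Filter.map u atTop ≤ 𝓝 y := huy
  obtain ⟨G₀, hG₀, -⟩ := hnoub ⟨Filter.map u atTop, inferInstance, inferInstance,
    mem_map.2 (univ_mem' hu), huR⟩
  obtain ⟨s, -, hs, hscl⟩ := hR.exists_isLUB (z '' M) (by rintro _ ⟨G, -, rfl⟩; exact hzR G)
    ⟨_, G₀, hG₀, rfl⟩ (by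
      rintro _ ⟨G, hG, rfl⟩ _ ⟨G', hG', rfl⟩
      by_cases h : G = G'
      · exact ⟨z G, ⟨G, hG, rfl⟩, le_rfl, by rw [h]⟩
      · rcases hM.1 hG hG' h with h | h
        · exact ⟨z G', ⟨G', hG', rfl⟩, h.2.le, le_rfl⟩
        · exact ⟨z G, ⟨G, hG, rfl⟩, le_rfl, h.2.le⟩)
  obtain ⟨G, hG, hsG⟩ := closure_minimal
    (by rintro _ ⟨G, hG, rfl⟩; exact ⟨G, hG, le_rfl⟩) hC hscl
  obtain ⟨G', hG', hlt⟩ := hub (fun _ => G) fun _ => hG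
  exact ((hs.1 ⟨G', hG', rfl⟩).trans hsG).not_gt (hlt 0)

end Sequential

theorem corollaryc {X Y : Type*}
    [SemilatticeInf X] [TopologicalSpace X] [SemilatticeInf Y] [TopologicalSpace Y] [T2Space Y]
    (hX : IsCompleteTop X) (hY : IsSemitopologicalSemilattice Y)
    (h : InfHom X Y) (hcont : Continuous h)
    (hcond : IsGDeltaBarSeparated Y ∨ ContinuousInf Y ∨ SequentialSpace Y ∨
      IsVecTTwoDelta Y ∨ IsFunctionallyHausdorff Y) :
    IsClosed (Set.range h) := by
  have hR := hX.range hY h hcont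
  rcases hcond with hc | hc | hc | hc | hc
  · exact hR.isClosed_of_isGDeltaBarSeparated hY hc
  · exact hR.isClosed_of_isGDeltaBarSeparated hY isGDeltaBarSeparated_of_continuousInf
  · exact hR.isClosed_of_sequentialSpace hY
  · exact isClosed_range_of_isVecTTwoDelta hX hY h hcont hc
  · exact isClosed_range_of_isVecTTwoDelta hX hY h hcont hc.isVecTTwoDelta
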